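/- Let $G=(V,E)$ be a finite simple graph and $k\ge 0$ an integer. In the edge colouring game on $G$ with $k$ colours, two players, Maker and Breaker, alternately assign a colour from $\{1,\dots,k\}$ to a previously uncoloured edge of $G$ such that adjacent edges never get the same colour; the game ends when no such move is left. Maker wins if at the end all edges are coloured, and Breaker wins otherwise. The game chromatic index $\chi'_g(G)$ is the smallest $k$ for which Maker has a winning strategy. Let $\Delta(G)$ denote the maximum degree of $G$, $v(G)$ its number of vertices, and $\log$ the natural logarithm. Theorem. There exist constants $C,c>0$ such that every finite simple graph $G$ with $\Delta(G)\ge C\cdot\log v(G)$ satisfies $$\chi'_g(G)\le (2-c)\,\Delta(G).$$ This holds no matter which of the two players makes the first move. -/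

import Mathlib

/-! The edge colouring game on a graph `G` with `k` colours, and the game chromatic index. -/

namespace EdgeColoringGame

/-- The two players. -/
inductive Player where
  | maker : Player
  | breaker : Player

/-- A position of the game: every edge of `G` is uncoloured (`none`) or has one of `k` colours. -/
abbrev Position {V : Type*} (G : SimpleGraph V) (k : ℕ) : Type _ :=
  G.edgeSet → Option (Fin k)

/-- Colour `i` is available at the edge `e`: no edge adjacent to `e` (i.e. different from `e` and
sharing an endpoint with `e`) has colour `i`. -/
def Available {V : Type*} {G : SimpleGraph V} {k : ℕ} (p : Position G k) (e : G.edgeSet)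
    (i : Fin k) : Prop :=
  ∀ f : G.edgeSet, G.lineGraph.Adj e f → p f ≠ some i

/-- `Move p q`: the position `q` arises from `p` by a legal move, that is, by giving one
uncoloured edge an available colour. Both players have the same legal moves. -/
def Move {V : Type*} {G : SimpleGraph V} {k : ℕ} (p q : Position G k) : Prop :=
  ∃ (e : G.edgeSet) (i : Fin k), p e = none ∧ Available p e i ∧
    q e = some i ∧ ∀ f : G.edgeSet, f ≠ e → q f = p f

/-- The game is over when no legal move is left. -/
def IsOver {V : Type*} {G : SimpleGraph V} {k : ℕ} (p : Position G k) : Prop :=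
  ∀ q : Position G k, ¬ Move p q

/-- All edges are coloured. -/
def IsComplete {V : Type*} {G : SimpleGraph V} {k : ℕ} (p : Position G k) : Prop :=
  ∀ e : G.edgeSet, p e ≠ none

/-- A strategy of Maker: for each position with Maker to move, the position after his move. -/
abbrev Strategy {V : Type*} (G : SimpleGraph V) (k : ℕ) : Type _ :=
  Position G k → Position G k

/-- `Reachable σ first t p`: with `first` making the first move and Maker following `σ`, while
Breaker plays arbitrary legal moves, the position `p` with player `t` to move can occur. -/
inductive Reachable {V : Type*} {G : SimpleGraph V} {k : ℕ} (σ : Strategy G k) (first : Player) :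
    Player → Position G k → Prop
  | start : Reachable σ first first (fun _ => none)
  | makerMove (p : Position G k) : Reachable σ first Player.maker p → Move p (σ p) →
      Reachable σ first Player.breaker (σ p)
  | breakerMove (p q : Position G k) : Reachable σ first Player.breaker p → Move p q →
      Reachable σ first Player.maker q

/-- `σ` is a winning strategy for Maker: it prescribes a legal move whenever Maker is to move and
the game is not over, and however Breaker plays, all edges are coloured when the game is over.
(Every play ends, since each move colours a new edge.) -/
def IsWinning {V : Type*} {G : SimpleGraph V} {k : ℕ} (σ : Strategy G k) (first : Player) : Prop :=
  (∀ p : Position G k, Reachable σ first Player.maker p → ¬ IsOver p → Move p (σ p)) ∧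
  (∀ (t : Player) (p : Position G k), Reachable σ first t p → IsOver p → IsComplete p)

/-- Maker has a winning strategy in the game on `G` with `k` colours in which `first` starts. -/
def MakerWins {V : Type*} (G : SimpleGraph V) (k : ℕ) (first : Player) : Prop :=
  ∃ σ : Strategy G k, IsWinning σ first

/-- The game chromatic index of `G`, when `first` starts: the smallest number of colours with
which Maker has a winning strategy. -/
noncomputable def gameChromaticIndex {V : Type*} (G : SimpleGraph V) (first : Player) : ℕ :=
  sInf {k : ℕ | MakerWins G k first}

/-- On a finite graph Maker wins with some number of colours. -/
theorem exists_makerWins {V : Type*} [Finite V] (G : SimpleGraph V) (first : Player) :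
    ∃ k : ℕ, MakerWins G k first := by
  classical
  have : Fintype G.edgeSet := Fintype.ofFinite _
  refine ⟨Fintype.card G.edgeSet + 1,
    fun p => if h : ∃ q, Move p q then h.choose else p, ?_, ?_⟩
  · intro p _ hp
    have h : ∃ q, Move p q := by
      by_contra h
      exact hp fun q hq => h ⟨q, hq⟩
    simp only [dif_pos h]
    exact h.choose_spec
  · intro _ p _ hover e he
    have hlt : (Finset.univ.image p).card <
        Fintype.card (Option (Fin (Fintype.card G.edgeSet + 1))) := by
      refine lt_of_le_of_lt Finset.card_image_le ?_
      simp
    obtain ⟨i, hi⟩ : ∃ i : Fin (Fintype.card G.edgeSet + 1), ∀ f, p f ≠ some i := by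
      by_contra! hc
      have hu : Finset.univ.image p = Finset.univ := by
        ext o
        cases o with
        | none => simpa using ⟨_, _, he⟩
        | some i => simpa using hc i
      rw [hu, Finset.card_univ] at hlt
      exact lt_irrefl _ hlt
    exact hover (Function.update p e (some i))
      ⟨e, i, he, fun f _ => hi f, by simp, fun f hf => by simp [hf]⟩

/-- Hence on a finite graph the minimum that defines the game chromatic index is attained. -/
theorem isLeast_gameChromaticIndex {V : Type*} [Finite V] (G : SimpleGraph V) (first : Player) :
    IsLeast {k : ℕ | MakerWins G k first} (gameChromaticIndex G first) :=
  ⟨Nat.sInf_mem (exists_makerWins G first), fun _ hk => Nat.sInf_le hk⟩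

end EdgeColoringGame

/-!
Maker plays at random near the edges coloured last, and the random strategy is derandomised by an
exponential potential. Write `D` for the maximum degree, let `k = 2 * D - w` with `w` a small
multiple of `D`, and write `A(x)` for the set of colours at `x`. If Breaker blocks an uncoloured
edge `uv`, then `A(u)` and `A(v)` cover all colours; as both have at most `D` elements, both have
at least `D - w`, and at most `w` colours are common. So it suffices that any two adjacent
vertices that are nearly full have more than `w` common colours.

At each turn Maker draws a legal move (an edge with a colour) uniformly among those on edges that
meet one of the two edges coloured last, his own and that of Breaker. These are `O(D ^ 2)` moves,
and each edge coloured at `x` is followed by a turn in which every legal move at `x` has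
probability at least of order `1 / D ^ 2`, whoever coloured it.

*Large sets of vertices have many colours.* While `m` vertices together have at most a little more
than `D` colours, an uncoloured edge from one of them to a vertex `z` with few colours can take
about `D` colours that are new to the union. Each such edge is answered whenever one of its ends
is touched, so for a large constant `m` the union exceeds `D` clearly once the `m` vertices are
nearly full.

*Pairs have common colours.* Let `T` be the set of colours at `v` when `v` first has `D - a` of
them, where `a` is a small multiple of `D`, and suppose that `u` is not ahead of `v` at that time.
Then `u` has about `a` uncoloured edges `uz`. Fewer than `m` of the `z` miss fewer than `a`
colours of `T`, since `m` such vertices would have a union of at most `D + 2 * a * m` colours.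
Along the other edges `u` can get colours of `T`: each turn near `u` or `z` has a chance of order
`a / D ^ 2` to colour `uz` by such a colour, and in the course of the next `a / 4` edges at `u`
this gives of order `a ^ 3 / D ^ 2` common colours.

Both facts are instances of a `Watch`, whose weight is the exponential of the accumulated exposure
minus the number of colours found. `Watch.weight_play_le` says that moves of Breaker do not
increase it, `Watch.sum_weight_play_le` that it does not increase on average when Maker draws at
random. Hence Maker has a move that does not increase the sum of all weights. Initially this sum
is at most `n ^ m + n ^ 2` on `n` vertices, which is less than `exp w` if `D` is a large multiple
of `log n`, and a failure of one of the two facts would mean a weight of at least `exp w`.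
-/

namespace EdgeColoringGame

open Finset
open scoped Classical

noncomputable section

/-! ### Positions, moves and palettes -/

variable {V : Type*} {G : SimpleGraph V} {k : ℕ}

/-- The colours on the coloured edges at `x`. In a proper position its cardinality is the number
of coloured edges at `x`, and it serves as the coloured degree of `x` throughout. -/
def palette (p : Position G k) (x : V) : Finset (Fin k) :=
  univ.filter fun i => ∃ e : G.edgeSet, x ∈ (e : Sym2 V) ∧ p e = some i

/-- `x` and `y` are joined by an edge that has no colour yet. -/
def Uncolored (p : Position G k) (x y : V) : Prop :=
  G.Adj x y ∧ ∀ e : G.edgeSet, (e : Sym2 V) = s(x, y) → p e = none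

/-- The triple `(x, y, i)` encodes the move that gives colour `i` to the edge `xy`; it is legal if
the edge is uncoloured and `i` is missing at both ends. Each move is encoded by two triples. -/
def Legal (p : Position G k) (m : V × V × Fin k) : Prop :=
  Uncolored p m.1 m.2.1 ∧ m.2.2 ∉ palette p m.1 ∧ m.2.2 ∉ palette p m.2.1

/-- The position after the move encoded by a triple. -/
def play (p : Position G k) (m : V × V × Fin k) : Position G k :=
  fun e => if (e : Sym2 V) = s(m.1, m.2.1) then some m.2.2 else p e

/-- Every coloured edge of `p` has the same colour in `q`. -/
def Extends (p q : Position G k) : Prop :=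
  ∀ e i, p e = some i → q e = some i

/-- Edges that share an endpoint never have the same colour. -/
def Proper (p : Position G k) : Prop :=
  ∀ (e f : G.edgeSet) (x : V) (i : Fin k), x ∈ (e : Sym2 V) → x ∈ (f : Sym2 V) →
    p e = some i → p f = some i → e = f

theorem mem_palette {p : Position G k} {x : V} {i : Fin k} :
    i ∈ palette p x ↔ ∃ e : G.edgeSet, x ∈ (e : Sym2 V) ∧ p e = some i := by
  simp [palette]

theorem Uncolored.symm {p : Position G k} {x y : V} (h : Uncolored p x y) : Uncolored p y x :=
  ⟨h.1.symm, fun e he => h.2 e (he.trans Sym2.eq_swap)⟩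

theorem Extends.refl (p : Position G k) : Extends p p := fun _ _ h => h

theorem Extends.trans {p q r : Position G k} (h : Extends p q) (h' : Extends q r) :
    Extends p r := fun e i he => h' e i (h e i he)

theorem Extends.palette_subset {p q : Position G k} (h : Extends p q) (x : V) :
    palette p x ⊆ palette q x := by
  intro i hi
  obtain ⟨e, hx, he⟩ := mem_palette.1 hi
  exact mem_palette.2 ⟨e, hx, h e i he⟩

theorem Extends.card_palette_le {p q : Position G k} (h : Extends p q) (x : V) :
    (palette p x).card ≤ (palette q x).card :=
  card_le_card (h.palette_subset x)

theorem Extends.uncolored {p q : Position G k} (h : Extends p q) {x y : V}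
    (hq : Uncolored q x y) : Uncolored p x y := by
  refine ⟨hq.1, fun e he => ?_⟩
  by_contra hne
  obtain ⟨i, hi⟩ := Option.ne_none_iff_exists'.1 hne
  have := h e i hi
  rw [hq.2 e he] at this
  simp at this

theorem Extends.proper {p q : Position G k} (h : Extends p q) (hq : Proper q) : Proper p :=
  fun e f x i hx hx' he hf => hq e f x i hx hx' (h e i he) (h f i hf)

theorem extends_play {p : Position G k} {m : V × V × Fin k} (hm : Legal p m) :
    Extends p (play p m) := by
  intro e i he
  by_cases h : (e : Sym2 V) = s(m.1, m.2.1)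
  · rw [hm.1.2 e h] at he
    simp at he
  · simp [play, h, he]

theorem palette_play {p : Position G k} {m : V × V × Fin k} (hm : Legal p m) (x : V) :
    palette (play p m) x =
      if x = m.1 ∨ x = m.2.1 then insert m.2.2 (palette p x) else palette p x := by
  obtain ⟨a, b, j⟩ := m
  have key : ∀ i, i ∈ palette (play p (a, b, j)) x ↔
      (i ∈ palette p x ∨ ((x = a ∨ x = b) ∧ i = j)) := by
    intro i
    constructor
    · intro hi
      obtain ⟨e, hx, he⟩ := mem_palette.1 hi
      by_cases h : (e : Sym2 V) = s(a, b)
      · right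
        simp only [play, h, if_true, Option.some.injEq] at he
        rw [h, Sym2.mem_iff] at hx
        exact ⟨hx, he.symm⟩
      · left
        simp only [play, h, if_false] at he
        exact mem_palette.2 ⟨e, hx, he⟩
    · rintro (hi | ⟨hx, rfl⟩)
      · exact (extends_play hm).palette_subset x hi
      · refine mem_palette.2 ⟨⟨s(a, b), hm.1.1⟩, by simpa [Sym2.mem_iff] using hx, by simp [play]⟩
  ext i
  rw [key]
  split_ifs with h
  · simp only [h, true_and, mem_insert]
    tauto
  · simp [h]

theorem card_palette_play_le {p : Position G k} {m : V × V × Fin k} (hm : Legal p m) (x : V) :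
    (palette (play p m) x).card ≤ (palette p x).card + 1 := by
  rw [palette_play hm]
  split_ifs
  · exact card_insert_le _ _
  · omega

theorem proper_play {p : Position G k} {m : V × V × Fin k} (hm : Legal p m) (hp : Proper p) :
    Proper (play p m) := by
  obtain ⟨a, b, j⟩ := m
  have key : ∀ (e f : G.edgeSet) (x : V), x ∈ (e : Sym2 V) → x ∈ (f : Sym2 V) →
      (e : Sym2 V) = s(a, b) → (f : Sym2 V) ≠ s(a, b) → p f ≠ some j := by
    intro e f x hx hx' he _ hpf
    have hj : j ∈ palette p x := mem_palette.2 ⟨f, hx', hpf⟩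
    rw [he, Sym2.mem_iff] at hx
    rcases hx with rfl | rfl
    · exact hm.2.1 hj
    · exact hm.2.2 hj
  intro e f x i hx hx' he hf
  by_cases h : (e : Sym2 V) = s(a, b) <;> by_cases h' : (f : Sym2 V) = s(a, b)
  · exact Subtype.ext (h.trans h'.symm)
  · simp only [play, h, h', if_true, if_false, Option.some.injEq] at he hf
    subst he
    exact absurd hf (key e f x hx hx' h h')
  · simp only [play, h, h', if_true, if_false, Option.some.injEq] at he hf
    subst hf
    exact absurd he (key f e x hx' hx h' h)
  · simp only [play, h, h', if_false] at he hf
    exact hp e f x i hx hx' he hf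

theorem move_play {p : Position G k} {m : V × V × Fin k} (hm : Legal p m) :
    Move p (play p m) := by
  obtain ⟨a, b, j⟩ := m
  refine ⟨⟨s(a, b), hm.1.1⟩, j, hm.1.2 _ rfl, ?_, by simp [play], ?_⟩
  · rintro f ⟨_, x, hx, hx'⟩ hf
    have hj : j ∈ palette p x := mem_palette.2 ⟨f, hx', hf⟩
    rcases Sym2.mem_iff.1 hx with rfl | rfl
    · exact hm.2.1 hj
    · exact hm.2.2 hj
  · intro f hf
    have : (f : Sym2 V) ≠ s(a, b) := fun h => hf (Subtype.ext h)
    simp [play, this]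

theorem Move.exists_legal {p q : Position G k} (h : Move p q) :
    ∃ m, Legal p m ∧ q = play p m := by
  obtain ⟨⟨e, he⟩, i, hpe, hav, hqe, hq⟩ := h
  induction e using Sym2.ind with
  | _ a b =>
  have hnot : ∀ x ∈ s(a, b), i ∉ palette p x := by
    intro x hx hi
    obtain ⟨f, hxf, hf⟩ := mem_palette.1 hi
    have hne : (⟨s(a, b), he⟩ : G.edgeSet) ≠ f := by
      rintro rfl
      rw [hpe] at hf
      simp at hf
    exact hav f ⟨hne, x, hx, hxf⟩ hf
  refine ⟨(a, b, i), ⟨⟨he, ?_⟩, hnot a (by simp), hnot b (by simp)⟩, ?_⟩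
  · intro f hf
    have : f = ⟨s(a, b), he⟩ := Subtype.ext hf
    rw [this, hpe]
  · funext f
    by_cases hf : (f : Sym2 V) = s(a, b)
    · have : f = ⟨s(a, b), he⟩ := Subtype.ext hf
      rw [this, hqe]
      simp [play]
    · have : f ≠ ⟨s(a, b), he⟩ := fun h => hf (congrArg Subtype.val h)
      simp [play, hf, hq f this]

/-! ### Watches and their exponential potentials -/

/-- A test that the random play of Maker should pass. The vertices in `verts` are watched, and the
test counts how many colours of `target` appear at one of them; it waits for more than `cap`.
Counting starts from the position `base`. A neighbour `z` of a watched vertex is of use only if at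
least `room` colours of `target` were missing at `z` in the position `base`; each watched vertex is
followed until it has received `quota` further colours; and `rate` is the weight of one unit of
exposure in the exponential potential `Watch.weight`. -/
structure Watch (G : SimpleGraph V) (k : ℕ) where
  verts : Finset V
  target : Finset (Fin k)
  base : Position G k
  room : ℕ
  cap : ℕ
  quota : ℕ
  rate : ℝ

namespace Watch

variable (A : Watch G k)

/-- The colours of the target that appear at a watched vertex. -/
def covered (p : Position G k) : Finset (Fin k) :=
  A.target ∩ A.verts.biUnion (palette p)

theorem covered_mono {p q : Position G k} (h : Extends p q) : A.covered p ⊆ A.covered q :=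
  inter_subset_inter_left (biUnion_mono fun x _ => h.palette_subset x)

end Watch

variable [Fintype V]

/-- The neighbours of `x`, as a finset that needs no decidability instance. -/
def nbrs (G : SimpleGraph V) (x : V) : Finset V := univ.filter (G.Adj x)

theorem card_palette_le_nbrs (p : Position G k) (x : V) :
    (palette p x).card ≤ (nbrs G x).card := by
  have h : ∀ i ∈ palette p x, ∃ y, y ∈ nbrs G x ∧ ∃ e : G.edgeSet, (e : Sym2 V) = s(x, y) ∧
      p e = some i := by
    intro i hi
    obtain ⟨e, hx, he⟩ := mem_palette.1 hi
    obtain ⟨y, hy⟩ := hx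
    refine ⟨y, ?_, e, hy, he⟩
    have := e.2
    rw [hy] at this
    simpa [nbrs] using this
  have : Nonempty V := ⟨x⟩
  choose! f hf using h
  refine card_le_card_of_injOn f (fun i hi => (hf i hi).1) ?_
  intro i hi j hj hij
  obtain ⟨-, e, he, hi'⟩ := hf i hi
  obtain ⟨-, e', he', hj'⟩ := hf j hj
  have hee : e = e' := Subtype.ext (by rw [he, he', hij])
  rw [hee, hj'] at hi'
  simpa using hi'.symm

/-- The edges at `y` coloured between `s` and `p` bring distinct new colours to `y`. -/
theorem card_colored_le {s p : Position G k} (hp : Proper p) (hsp : Extends s p) (y : V)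
    (F : Finset V) (hF : ∀ z ∈ F, Uncolored s y z ∧ ¬ Uncolored p y z) :
    F.card ≤ (palette p y).card - (palette s y).card := by
  rw [← card_sdiff_of_subset (hsp.palette_subset y)]
  have h : ∀ z ∈ F, ∃ i, ∃ e : G.edgeSet, (e : Sym2 V) = s(y, z) ∧ p e = some i := by
    intro z hz
    obtain ⟨hu, hn⟩ := hF z hz
    by_contra! hc
    refine hn ⟨hu.1, fun e he => ?_⟩
    by_contra hne
    obtain ⟨i, hi⟩ := Option.ne_none_iff_exists'.1 hne
    exact hc i e he hi
  rcases F.eq_empty_or_nonempty with rfl | ⟨z₀, hz₀⟩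
  · simp
  have : Nonempty (Fin k) := ⟨(h z₀ hz₀).choose⟩
  choose! f hf using h
  refine card_le_card_of_injOn f ?_ ?_
  · intro z hz
    obtain ⟨e, he, hpe⟩ := hf z hz
    have hy : y ∈ (e : Sym2 V) := by rw [he]; simp
    rw [coe_sdiff, Set.mem_sdiff]
    refine ⟨mem_coe.2 (mem_palette.2 ⟨e, hy, hpe⟩), fun hs => ?_⟩
    obtain ⟨e', hy', he'⟩ := mem_palette.1 (mem_coe.1 hs)
    have heq := hp e' e y _ hy' hy (hsp e' _ he') hpe
    rw [heq, (hF z hz).1.2 _ he] at he'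
    simp at he'
  · intro z hz z' hz' hzz
    obtain ⟨e, he, hpe⟩ := hf z hz
    obtain ⟨e', he', hpe'⟩ := hf z' hz'
    have hy : y ∈ (e : Sym2 V) := by rw [he]; simp
    have hy' : y ∈ (e' : Sym2 V) := by rw [he']; simp
    have heq := hp e e' y (f z) hy hy' hpe (by rw [hzz]; exact hpe')
    rw [heq, he'] at he
    exact (Sym2.congr_right.1 he).symm

theorem card_nbrs_le {p : Position G k} (hp : Proper p) (y : V) :
    (nbrs G y).card ≤ ((nbrs G y).filter (Uncolored p y ·)).card + (palette p y).card := by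
  have h0 : Extends (fun _ => none : Position G k) p := by
    intro e i h
    simp at h
  have := card_colored_le hp h0 y ((nbrs G y).filter (¬ Uncolored p y ·)) (by
    intro z hz
    rw [mem_filter] at hz
    exact ⟨⟨by simpa [nbrs] using hz.1, fun _ _ => rfl⟩, hz.2⟩)
  have h2 := card_filter_add_card_filter_not (s := nbrs G y) (Uncolored p y ·)
  omega

/-- The vertices that received a colour between `P` and `p`. -/
def touched (P p : Position G k) : Finset V :=
  univ.filter fun x => (palette P x).card < (palette p x).card

theorem touched_play_subset {P p : Position G k} {m : V × V × Fin k} (hm : Legal p m) :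
    touched P (play p m) ⊆ touched P p ∪ {m.1, m.2.1} := by
  intro x hx
  simp only [touched, mem_filter, mem_univ, true_and, mem_union, mem_insert, mem_singleton] at hx ⊢
  by_cases h : x = m.1 ∨ x = m.2.1
  · exact Or.inr h
  · rw [palette_play hm, if_neg h] at hx
    exact Or.inl hx

theorem card_touched_play_le {P p : Position G k} {m : V × V × Fin k} (hm : Legal p m) :
    (touched P (play p m)).card ≤ (touched P p).card + 2 :=
  (card_le_card (touched_play_subset hm)).trans
    ((card_union_le _ _).trans (Nat.add_le_add_left card_le_two _))

theorem touched_self (p : Position G k) : touched p p = ∅ := by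
  simp [touched]

/-- The legal moves at an edge with an end touched since `P`. Maker draws from these moves, where
`P` is the position before his previous move: so each coloured edge `e`, of either player, is
answered by exactly one draw that includes the legal moves around `e`. -/
def candidates (P p : Position G k) : Finset (V × V × Fin k) :=
  univ.filter fun m => Legal p m ∧ (m.1 ∈ touched P p ∨ m.2.1 ∈ touched P p)

theorem card_candidates_le {D : ℕ} (hD : ∀ x, (nbrs G x).card ≤ D) (P p : Position G k) :
    (candidates P p).card ≤ 2 * (touched P p).card * (D * k) := by
  set A := (touched P p).biUnion fun x => ((nbrs G x) ×ˢ (univ : Finset (Fin k))).image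
    fun a => (x, a.1, a.2)
  set B := (touched P p).biUnion fun x => ((nbrs G x) ×ˢ (univ : Finset (Fin k))).image
    fun a => (a.1, x, a.2)
  have hA : A.card ≤ (touched P p).card * (D * k) := by
    refine card_biUnion_le_card_mul _ _ _ fun x _ => card_image_le.trans ?_
    rw [card_product, card_univ, Fintype.card_fin]
    exact Nat.mul_le_mul_right _ (hD x)
  have hB : B.card ≤ (touched P p).card * (D * k) := by
    refine card_biUnion_le_card_mul _ _ _ fun x _ => card_image_le.trans ?_
    rw [card_product, card_univ, Fintype.card_fin]
    exact Nat.mul_le_mul_right _ (hD x)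
  have hsub : candidates P p ⊆ A ∪ B := by
    rintro ⟨a, b, j⟩ hm
    simp only [candidates, mem_filter, mem_univ, true_and] at hm
    have hab := hm.1.1.1
    rw [mem_union]
    rcases hm.2 with h | h
    · left
      exact mem_biUnion.2 ⟨a, h, mem_image.2 ⟨(b, j), by simpa [nbrs] using hab, rfl⟩⟩
    · right
      exact mem_biUnion.2 ⟨b, h, mem_image.2 ⟨(a, j), by simpa [nbrs] using hab.symm, rfl⟩⟩
  have := (card_le_card hsub).trans (card_union_le _ _)
  nlinarith

/-! ### Exposure and weight of a watch -/

namespace Watch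

variable (A : Watch G k)

/-- The neighbours of `y` along which `y` can be expected to receive colours of the target. -/
def partners (y : V) : Finset V :=
  univ.filter fun z => Uncolored A.base y z ∧ A.room ≤ (A.target \ palette A.base z).card

theorem mem_partners {y z : V} : z ∈ A.partners y ↔
    Uncolored A.base y z ∧ A.room ≤ (A.target \ palette A.base z).card := by
  simp [partners]

/-- The number of colours received since the base position by `y` and by `z`, up to position `X`.
-/
def touches (X : Position G k) (y z : V) : ℕ :=
  ((palette X y).card - (palette A.base y).card) + ((palette X z).card - (palette A.base z).card)

/-- The exposure of `y` while it is followed: each partner `z` whose edge to `y` is still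
uncoloured contributes the number of colours that `y` and `z` received; each of these was answered
by a turn of Maker that could have coloured `yz`. The truncation at `quota - 2` keeps colours of
the target free at `z`; the `2` accounts for the lag between `X` and `p`. -/
def live (X p : Position G k) (y : V) : ℕ :=
  ∑ z ∈ (A.partners y).filter (Uncolored p y ·), min (A.touches X y z) (A.quota - 2)

/-- The exposure of `y` to colours of the target. Here `p` is the current position and `X` the one
before the last move of Maker, so that edges coloured after `X` have not been answered yet. Once
`y` has received `quota` colours the exposure is frozen at a value that `live` has then reached.
-/
def exposure (X p : Position G k) (y : V) : ℕ :=
  if (palette A.base y).card + A.quota ≤ (palette p y).card then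
    ((A.partners y).card - A.quota) * (A.quota - 2)
  else A.live X p y

/-- The exponential potential of a watch: it is large only if much exposure has produced few
colours. It is switched off once the watch has seen more than `cap` colours. -/
def weight (X p : Position G k) : ℝ :=
  if (A.covered p).card ≤ A.cap then
    Real.exp (A.rate * (∑ y ∈ A.verts, A.exposure X p y : ℕ) - (A.covered p).card)
  else 0

theorem weight_nonneg (X p : Position G k) : 0 ≤ A.weight X p := by
  unfold weight
  split_ifs
  · positivity
  · exact le_rfl

theorem card_partners_le {p : Position G k} (hp : Proper p) (hs : Extends A.base p) (y : V) :
    (A.partners y).card ≤ ((A.partners y).filter (Uncolored p y ·)).card +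
      ((palette p y).card - (palette A.base y).card) := by
  have h1 := card_colored_le hp hs y ((A.partners y).filter (¬ Uncolored p y ·)) (by
    intro z hz
    rw [mem_filter, partners, mem_filter] at hz
    exact ⟨hz.1.2.1, hz.2⟩)
  have h2 := card_filter_add_card_filter_not (s := A.partners y) (Uncolored p y ·)
  omega

/-- A move that is not yet answered does not increase the exposure. At the moment of freezing, at
most `quota - 1` partners were lost earlier, and each of the others contributes `quota - 2`. -/
theorem exposure_play_le {X p : Position G k} {m : V × V × Fin k} (hm : Legal p m)
    (hp : Proper p) (hs : Extends A.base p) (y : V)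
    (hX : (palette (play p m) y).card ≤ (palette X y).card + 2) :
    A.exposure X (play p m) y ≤ A.exposure X p y := by
  have hext := extends_play hm
  have hle := hext.card_palette_le y
  unfold exposure
  by_cases h : (palette A.base y).card + A.quota ≤ (palette p y).card
  · rw [if_pos h, if_pos (h.trans hle)]
  rw [if_neg h]
  split_ifs with h'
  · have hcard := A.card_partners_le hp hs y
    -- All contributions have reached the truncation, as `y` alone received `quota - 2` colours.
    have hlive : A.live X p y =
        ((A.partners y).filter (Uncolored p y ·)).card * (A.quota - 2) := by
      unfold live
      rw [sum_congr rfl (g := fun _ => A.quota - 2), sum_const, smul_eq_mul]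
      intro z _
      apply min_eq_right
      unfold touches
      omega
    rw [hlive]
    exact Nat.mul_le_mul_right _ (by omega)
  · unfold live
    refine sum_le_sum_of_subset fun z hz => ?_
    rw [mem_filter] at hz ⊢
    exact ⟨hz.1, hext.uncolored hz.2⟩

theorem weight_play_le (hr : 0 ≤ A.rate) {X p : Position G k} {m : V × V × Fin k}
    (hm : Legal p m) (hp : Proper p) (hs : Extends A.base p)
    (hX : ∀ y, (palette (play p m) y).card ≤ (palette X y).card + 2) :
    A.weight X (play p m) ≤ A.weight X p := by
  have hcov := card_le_card (A.covered_mono (extends_play hm))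
  by_cases h : (A.covered (play p m)).card ≤ A.cap
  · unfold weight
    rw [if_pos h, if_pos (hcov.trans h)]
    have hE : ∑ y ∈ A.verts, A.exposure X (play p m) y ≤ ∑ y ∈ A.verts, A.exposure X p y :=
      sum_le_sum fun y _ => A.exposure_play_le hm hp hs y (hX y)
    have hE' : ((∑ y ∈ A.verts, A.exposure X (play p m) y : ℕ) : ℝ) ≤
        (∑ y ∈ A.verts, A.exposure X p y : ℕ) := by exact_mod_cast hE
    have hcov' : ((A.covered p).card : ℝ) ≤ (A.covered (play p m)).card := by exact_mod_cast hcov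
    exact Real.exp_le_exp.2 (sub_le_sub (mul_le_mul_of_nonneg_left hE' hr) hcov')
  · have h0 : A.weight X (play p m) = 0 := if_neg h
    rw [h0]
    exact A.weight_nonneg X p

/-- The partners of `y` whose contribution to the exposure grows with the next move of Maker. -/
def fresh (P p : Position G k) (y : V) : Finset V :=
  ((A.partners y).filter (Uncolored p y ·)).filter fun z =>
    (y ∈ touched P p ∨ z ∈ touched P p) ∧ A.touches P y z < A.quota - 2

theorem exposure_advance_le {P p : Position G k}
    (hd : ∀ x, (palette p x).card ≤ (palette P x).card + 2) (y : V) :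
    A.exposure p p y ≤ A.exposure P p y + 4 * (A.fresh P p y).card := by
  unfold exposure
  split_ifs with h
  · omega
  · have hf : (A.fresh P p y).card = ∑ z ∈ (A.partners y).filter (Uncolored p y ·),
        if (y ∈ touched P p ∨ z ∈ touched P p) ∧ A.touches P y z < A.quota - 2 then 1 else 0 := by
      rw [fresh, card_filter]
    rw [hf, mul_sum]
    unfold live
    rw [← sum_add_distrib]
    refine sum_le_sum fun z _ => ?_
    have hy := hd y
    have hz := hd z
    split_ifs with hc
    · unfold touches
      omega
    · by_cases ht : A.touches P y z < A.quota - 2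
      · have hn : ¬ (y ∈ touched P p ∨ z ∈ touched P p) := fun hh => hc ⟨hh, ht⟩
        simp only [touched, mem_filter, mem_univ, true_and, not_or, not_lt] at hn
        unfold touches
        omega
      · omega

/-- Each fresh pair `(y, z)` provides `g` colours of the target that are missing at `z` and at all
watched vertices, and each gives a candidate move that covers a new colour. -/
theorem card_fresh_mul_le {P p : Position G k} {g : ℕ} {S : Finset (V × V × Fin k)}
    (hs : Extends A.base p)
    (hd : ∀ x, (palette p x).card ≤ (palette P x).card + 2)
    (hg : A.quota + A.cap + g ≤ A.room) (hcap : (A.covered p).card ≤ A.cap)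
    (hS : candidates P p ⊆ S) :
    (∑ y ∈ A.verts, (A.fresh P p y).card) * g ≤
      (S.filter fun m => (A.covered p).card < (A.covered (play p m)).card).card := by
  -- At most `quota` colours came to `z` since the base, and at most `cap` colours are covered.
  set good : V → Finset (Fin k) := fun z => (A.target \ palette p z) \ A.verts.biUnion (palette p)
    with hgood
  have hcard : ∀ y ∈ A.verts, ∀ z ∈ A.fresh P p y, g ≤ (good z).card := by
    intro y _ z hz
    simp only [fresh, partners, mem_filter, mem_univ, true_and] at hz
    obtain ⟨⟨⟨-, hroom⟩, -⟩, -, ht⟩ := hz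
    have hsub : A.target \ palette A.base z ⊆
        good z ∪ ((palette p z \ palette A.base z) ∪ A.covered p) := by
      intro i hi
      simp only [hgood, covered, mem_union, mem_sdiff, mem_inter] at hi ⊢
      tauto
    have h1 := card_le_card hsub
    have h2 := card_union_le (good z) ((palette p z \ palette A.base z) ∪ A.covered p)
    have h3 := card_union_le (palette p z \ palette A.base z) (A.covered p)
    have h4 := card_sdiff_of_subset (hs.palette_subset z)
    have h5 := hd z
    unfold touches at ht
    omega
  set J : Finset (Σ _ : V, Σ _ : V, Fin k) :=
    A.verts.sigma fun y => (A.fresh P p y).sigma fun z => good z with hJ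
  have hJcard : (∑ y ∈ A.verts, (A.fresh P p y).card) * g ≤ J.card := by
    rw [hJ, card_sigma, sum_mul]
    refine sum_le_sum fun y hy => ?_
    rw [card_sigma, ← smul_eq_mul]
    exact card_nsmul_le_sum _ _ _ fun z hz => hcard y hy z hz
  refine hJcard.trans (card_le_card_of_injOn (fun j => (j.1, j.2.1, j.2.2)) ?_ ?_)
  · rintro ⟨y, z, i⟩ hj
    replace hj := mem_coe.1 hj
    simp only [hJ, mem_sigma, fresh, partners, mem_filter, mem_univ, true_and,
      hgood, mem_sdiff, mem_biUnion, not_exists, not_and] at hj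
    obtain ⟨hy, ⟨⟨⟨hu0, hroom⟩, hu⟩, htouch, ht⟩, ⟨hiT, hiz⟩, hiY⟩ := hj
    have hl : Legal p (y, z, i) := ⟨hu, hiY y hy, hiz⟩
    rw [mem_coe, mem_filter]
    refine ⟨hS ?_, ?_⟩
    · simp only [candidates, mem_filter, mem_univ, true_and]
      exact ⟨hl, htouch⟩
    · refine card_lt_card ((ssubset_iff_of_subset (A.covered_mono (extends_play hl))).2 ⟨i, ?_, ?_⟩)
      · refine mem_inter.2 ⟨hiT, mem_biUnion.2 ⟨y, hy, ?_⟩⟩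
        rw [palette_play hl, if_pos (Or.inl rfl)]
        exact mem_insert_self _ _
      · intro hmem
        obtain ⟨x, hx, hix⟩ := mem_biUnion.1 (mem_inter.1 hmem).2
        exact hiY x hx hix
  · rintro ⟨y, z, i⟩ _ ⟨y', z', i'⟩ _ h
    simp only [Prod.mk.injEq] at h
    obtain ⟨rfl, rfl, rfl⟩ := h
    rfl

/-- For a uniformly random move of Maker from `S`, the weight is a supermartingale: the exposure
grows by at most four for each fresh pair, while each fresh pair provides `g` moves that bring a
new colour of the target to a watched vertex. -/
theorem sum_weight_play_le (hr : 0 ≤ A.rate) {P p : Position G k} {g K : ℕ}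
    {S : Finset (V × V × Fin k)} (hp : Proper p) (hs : Extends A.base p)
    (hd : ∀ x, (palette p x).card ≤ (palette P x).card + 2)
    (hg : A.quota + A.cap + g ≤ A.room)
    (hrate : 8 * K * A.rate ≤ g) (hS : candidates P p ⊆ S) (hleg : ∀ m ∈ S, Legal p m)
    (hK : S.card ≤ K) :
    ∑ m ∈ S, A.weight p (play p m) ≤ S.card * A.weight P p := by
  by_cases hcap : (A.covered p).card ≤ A.cap
  swap
  · have h0 : ∀ m ∈ S, A.weight p (play p m) = 0 := by
      intro m hm
      have := card_le_card (A.covered_mono (extends_play (hleg m hm)))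
      exact if_neg (by omega)
    rw [sum_congr rfl h0, sum_const_zero]
    exact mul_nonneg (Nat.cast_nonneg _) (A.weight_nonneg P p)
  set R := ∑ y ∈ A.verts, (A.fresh P p y).card with hR
  set H := S.filter fun m => (A.covered p).card < (A.covered (play p m)).card with hH
  have hRH : R * g ≤ H.card := A.card_fresh_mul_le hs hd hg hcap hS
  have hHS : H.card ≤ S.card := card_filter_le _ _
  have hE : ∑ y ∈ A.verts, A.exposure p p y ≤ ∑ y ∈ A.verts, A.exposure P p y + 4 * R := by
    rw [hR, mul_sum, ← sum_add_distrib]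
    exact sum_le_sum fun y _ => A.exposure_advance_le hd y
  have hE' : ((∑ y ∈ A.verts, A.exposure p p y : ℕ) : ℝ) ≤
      (∑ y ∈ A.verts, A.exposure P p y : ℕ) + 4 * R := by exact_mod_cast hE
  have hw0 : A.weight P p = Real.exp (A.rate * (∑ y ∈ A.verts, A.exposure P p y : ℕ) -
      (A.covered p).card) := if_pos hcap
  have hself : A.weight p p ≤ Real.exp (4 * A.rate * R) * A.weight P p := by
    rw [hw0, ← Real.exp_add]
    unfold weight
    rw [if_pos hcap]
    refine Real.exp_le_exp.2 ?_
    have := mul_le_mul_of_nonneg_left hE' hr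
    linarith
  have hhalf : Real.exp (-1) ≤ 1 / 2 := by
    rw [Real.exp_neg, one_div]
    exact inv_anti₀ (by norm_num) (by have := Real.add_one_le_exp (1 : ℝ); linarith)
  have hterm : ∀ m ∈ S, A.weight p (play p m) ≤
      A.weight p p *
        (1 - if (A.covered p).card < (A.covered (play p m)).card then 1 / 2 else 0) := by
    intro m hm
    have hl := hleg m hm
    have hX : ∀ y, (palette (play p m) y).card ≤ (palette p y).card + 2 := fun y =>
      (card_palette_play_le hl y).trans (by omega)
    split_ifs with hlt
    · by_cases h : (A.covered (play p m)).card ≤ A.cap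
      · have hEm : ∑ y ∈ A.verts, A.exposure p (play p m) y ≤ ∑ y ∈ A.verts, A.exposure p p y :=
          sum_le_sum fun y _ => A.exposure_play_le hl hp hs y (hX y)
        have hEm' : ((∑ y ∈ A.verts, A.exposure p (play p m) y : ℕ) : ℝ) ≤
            (∑ y ∈ A.verts, A.exposure p p y : ℕ) := by exact_mod_cast hEm
        have hlt' : ((A.covered p).card : ℝ) + 1 ≤ (A.covered (play p m)).card := by
          exact_mod_cast hlt
        have h1 : A.weight p (play p m) ≤ A.weight p p * Real.exp (-1) := by
          unfold weight
          rw [if_pos h, if_pos hcap, ← Real.exp_add]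
          refine Real.exp_le_exp.2 ?_
          have := mul_le_mul_of_nonneg_left hEm' hr
          linarith
        have h2 := mul_le_mul_of_nonneg_left hhalf (A.weight_nonneg p p)
        linarith
      · have h0 : A.weight p (play p m) = 0 := if_neg h
        rw [h0]
        have := A.weight_nonneg p p
        linarith
    · rw [sub_zero, mul_one]
      exact A.weight_play_le hr hl hp hs hX
  have hsum : ∑ m ∈ S, A.weight p (play p m) ≤ A.weight p p * (S.card - H.card / 2) := by
    refine (sum_le_sum hterm).trans (le_of_eq ?_)
    rw [← mul_sum, sum_sub_distrib, sum_const, ← sum_filter, sum_const]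
    simp only [nsmul_eq_mul, ← hH]
    ring
  have hHS' : (H.card : ℝ) ≤ S.card := by exact_mod_cast hHS
  have hRH' : (R : ℝ) * g ≤ H.card := by exact_mod_cast hRH
  have hKS : (S.card : ℝ) ≤ K := by exact_mod_cast hK
  rcases S.eq_empty_or_nonempty with rfl | hne
  · simp
  have hSpos : (0 : ℝ) < S.card := by exact_mod_cast hne.card_pos
  have hfac : Real.exp (4 * A.rate * R) * (S.card - H.card / 2) ≤ S.card := by
    have h1 : (S.card : ℝ) - H.card / 2 ≤ S.card * Real.exp (-(H.card / (2 * S.card))) := by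
      have := Real.add_one_le_exp (-((H.card : ℝ) / (2 * S.card)))
      have h2 := mul_le_mul_of_nonneg_left this hSpos.le
      have h3 : (S.card : ℝ) * (-((H.card : ℝ) / (2 * S.card)) + 1) = S.card - H.card / 2 := by
        field_simp
        ring
      linarith
    have h4 : 4 * A.rate * R ≤ H.card / (2 * S.card) := by
      rw [le_div_iff₀ (by positivity)]
      have h5 : 8 * (S.card : ℝ) * A.rate ≤ g := by
        have := mul_le_mul_of_nonneg_right hKS hr
        linarith
      have h6 := mul_le_mul_of_nonneg_left h5 (Nat.cast_nonneg (α := ℝ) R)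
      linarith
    calc Real.exp (4 * A.rate * R) * (S.card - H.card / 2)
        ≤ Real.exp (4 * A.rate * R) * (S.card * Real.exp (-(H.card / (2 * S.card)))) :=
          mul_le_mul_of_nonneg_left h1 (Real.exp_pos _).le
      _ = S.card * Real.exp (4 * A.rate * R + -(H.card / (2 * S.card))) := by
          rw [Real.exp_add]; ring
      _ ≤ S.card * 1 := by
          refine mul_le_mul_of_nonneg_left (Real.exp_le_one_iff.2 (by linarith)) hSpos.le
      _ = S.card := mul_one _
  have hnn : (0 : ℝ) ≤ S.card - H.card / 2 := by linarith
  calc ∑ m ∈ S, A.weight p (play p m) ≤ A.weight p p * (S.card - H.card / 2) := hsum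
    _ ≤ (Real.exp (4 * A.rate * R) * A.weight P p) * (S.card - H.card / 2) :=
        mul_le_mul_of_nonneg_right hself hnn
    _ = (Real.exp (4 * A.rate * R) * (S.card - H.card / 2)) * A.weight P p := by ring
    _ ≤ S.card * A.weight P p := mul_le_mul_of_nonneg_right hfac (A.weight_nonneg P p)

end Watch

/-! ### The strategy of Maker -/

/-- The numbers used in the strategy. There are `2 * D - w` colours, `D` bounds the degrees, and
the colour set of a vertex is recorded when it has `D - a` colours. The numbers with index `1`
belong to the watches on sets of `m` vertices, those with index `2` to the watches on pairs of
vertices, and `K` bounds the number of moves among which Maker draws. -/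
structure Params where
  D : ℕ
  a : ℕ
  w : ℕ
  m : ℕ
  L₁ : ℕ
  W : ℕ
  g₁ : ℕ
  b₁ : ℝ
  L₂ : ℕ
  g₂ : ℕ
  b₂ : ℝ
  K : ℕ
  card_le : 8 * (D * (2 * D - w)) + 1 ≤ K
  a_le : 2 * a ≤ D
  union_le : D + m * (2 * a) ≤ W
  quota₁_pos : 0 < L₁
  quota₁_le : L₁ ≤ D - 2 * a
  room₁ : L₁ + W + g₁ ≤ 2 * D - w
  rate₁_nonneg : 0 ≤ b₁
  rate₁_le : 8 * K * b₁ ≤ g₁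
  gain₁ : (W : ℝ) + w ≤ b₁ * (m * ((D - 2 * a - L₁) * (L₁ - 2)) : ℕ)
  quota₂_pos : 0 < L₂
  room₂ : L₂ + w + g₂ ≤ a
  rate₂_nonneg : 0 ≤ b₂
  rate₂_le : 8 * K * b₂ ≤ g₂
  gain₂ : 2 * (w : ℝ) ≤ b₂ * ((a - w - m - L₂) * (L₂ - 2) : ℕ)

namespace Watch

variable (A : Watch G k)

theorem exposure_base (hq : 0 < A.quota) {X : Position G k} (hX : Extends X A.base) (y : V) :
    A.exposure X A.base y = 0 := by
  unfold exposure
  rw [if_neg (by omega)]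
  refine sum_eq_zero fun z _ => ?_
  have h1 := hX.card_palette_le y
  have h2 := hX.card_palette_le z
  unfold touches
  omega

/-- At its base position a watch has no exposure. -/
theorem weight_base (hq : 0 < A.quota) {X : Position G k} (hX : Extends X A.base) :
    A.weight X A.base = if (A.covered A.base).card ≤ A.cap then
      Real.exp (-(A.covered A.base).card) else 0 := by
  unfold weight
  rw [sum_eq_zero fun y _ => A.exposure_base hq hX y]
  simp

theorem weight_base_le_one (hq : 0 < A.quota) {X : Position G k} (hX : Extends X A.base) :
    A.weight X A.base ≤ 1 := by
  rw [A.weight_base hq hX]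
  split_ifs
  · exact Real.exp_le_one_iff.2 (by simp)
  · exact zero_le_one

end Watch

namespace Params

variable (Q : Params)

/-- The number of colours. -/
abbrev colors : ℕ := 2 * Q.D - Q.w

/-- The watch that counts all colours at the vertices of `Y`, from the start of the game. -/
def unionWatch (Y : Finset V) : Watch G Q.colors where
  verts := Y
  target := univ
  base := fun _ => none
  room := Q.colors
  cap := Q.W
  quota := Q.L₁
  rate := Q.b₁

/-- The watch that counts the colours at `u` among those that were present at `v` in position `s`.
-/
def pairWatch (s : Position G Q.colors) (u v : V) : Watch G Q.colors where
  verts := {u}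
  target := palette s v
  base := s
  room := Q.a
  cap := Q.w
  quota := Q.L₂
  rate := Q.b₂

/-- The total potential: all watches on `m`-sets, and for all `u`, `v` the watch for the recorded
colours of `v` to appear at `u`. -/
def danger (snap : V → Position G Q.colors) (X p : Position G Q.colors) : ℝ :=
  ∑ Y ∈ powersetCard Q.m univ, (Q.unionWatch Y).weight X p +
    ∑ u, ∑ v, (Q.pairWatch (snap v) u v).weight X p

/-- Any `m` vertices with many colours have more than `W` colours in their union. -/
def WellSpread (p : Position G Q.colors) : Prop :=
  ∀ Y : Finset V, Y.card = Q.m → (∀ y ∈ Y, Q.D - 2 * Q.a ≤ (palette p y).card) →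
    Q.W < (Y.biUnion (palette p)).card

/-- The invariant of the play: `p` is the current position, `X` the one before the last move of
Maker, and `snap v` the position when `v` first had `D - a` colours, or `p` if that is still to
come. The number `t` is `1` when Breaker and `2` when Maker is to move; it bounds the number of
edges coloured since `X`. -/
structure Tracked (snap : V → Position G Q.colors) (X p : Position G Q.colors) (t : ℕ) : Prop where
  proper : Proper p
  ext : Extends X p
  snap_ext : ∀ v, Extends (snap v) p
  card_touched : (touched X p).card ≤ 2 * t
  step : ∀ x, (palette p x).card ≤ (palette X x).card + t
  chain : ∀ u v, Extends (snap u) (snap v) ∨ Extends (snap v) (snap u)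
  snap_le : ∀ v, (palette (snap v) v).card ≤ Q.D - Q.a
  snap_eq : ∀ v, (palette (snap v) v).card < Q.D - Q.a → snap v = p
  spread : ∀ v, Q.WellSpread (snap v)
  danger_lt : Q.danger snap X p < Real.exp Q.w

/-- The recorded positions after a move to `q`. -/
def advance (snap : V → Position G Q.colors) (q : Position G Q.colors) (v : V) :
    Position G Q.colors :=
  if (palette (snap v) v).card < Q.D - Q.a then q else snap v

theorem weight_unionWatch_le_danger (snap : V → Position G Q.colors) (X p : Position G Q.colors)
    {Y : Finset V} (hY : Y.card = Q.m) :
    (Q.unionWatch Y).weight X p ≤ Q.danger snap X p := by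
  have h1 : (Q.unionWatch Y).weight X p ≤
      ∑ Y ∈ powersetCard Q.m univ, (Q.unionWatch Y).weight X p :=
    single_le_sum (f := fun Y => (Q.unionWatch Y).weight X p)
      (fun Y _ => Watch.weight_nonneg _ _ _) (mem_powersetCard.2 ⟨subset_univ _, hY⟩)
  have h2 : 0 ≤ ∑ u, ∑ v, (Q.pairWatch (snap v) u v).weight X p :=
    sum_nonneg fun u _ => sum_nonneg fun v _ => Watch.weight_nonneg _ _ _
  unfold danger
  linarith

theorem weight_pairWatch_le_danger (snap : V → Position G Q.colors) (X p : Position G Q.colors)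
    (u v : V) :
    (Q.pairWatch (snap v) u v).weight X p ≤ Q.danger snap X p := by
  have h1 : (Q.pairWatch (snap v) u v).weight X p ≤
      ∑ v, (Q.pairWatch (snap v) u v).weight X p :=
    single_le_sum (f := fun v => (Q.pairWatch (snap v) u v).weight X p)
      (fun v _ => Watch.weight_nonneg _ _ _) (mem_univ v)
  have h2 : ∑ v, (Q.pairWatch (snap v) u v).weight X p ≤
      ∑ u, ∑ v, (Q.pairWatch (snap v) u v).weight X p :=
    single_le_sum (f := fun u => ∑ v, (Q.pairWatch (snap v) u v).weight X p)
      (fun u _ => sum_nonneg fun v _ => Watch.weight_nonneg _ _ _) (mem_univ u)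
  have h3 : 0 ≤ ∑ Y ∈ powersetCard Q.m univ, (Q.unionWatch Y).weight X p :=
    sum_nonneg fun Y _ => Watch.weight_nonneg _ _ _
  unfold danger
  linarith

theorem wellSpread_of_danger_lt {snap : V → Position G Q.colors} {X p : Position G Q.colors}
    (h : Q.danger snap X p < Real.exp Q.w) : Q.WellSpread p := by
  intro Y hY hd
  by_contra! hW
  have hcov : ((Q.unionWatch Y).covered p) = Y.biUnion (palette p) := by
    simp [Watch.covered, unionWatch]
  have hexp : ∀ y ∈ Y, (Q.D - 2 * Q.a - Q.L₁) * (Q.L₁ - 2) ≤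
      (Q.unionWatch Y).exposure X p y := by
    intro y hy
    have hpart : nbrs G y ⊆ (Q.unionWatch (G := G) Y).partners y := by
      intro z hz
      have hz' : G.Adj y z := by simpa [nbrs] using hz
      refine (Watch.mem_partners _).2 ⟨⟨hz', fun _ _ => rfl⟩, ?_⟩
      simp [unionWatch, palette]
    have h1 := card_le_card hpart
    have h2 := card_palette_le_nbrs p y
    have h3 := hd y hy
    have h4 := Q.quota₁_le
    unfold Watch.exposure
    rw [if_pos]
    · exact Nat.mul_le_mul_right _ (by simp only [unionWatch] at *; omega)
    · simp only [unionWatch]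
      have : palette (fun _ => none : Position G Q.colors) y = ∅ := by simp [palette]
      rw [this, card_empty]
      omega
  have hsum : Q.m * ((Q.D - 2 * Q.a - Q.L₁) * (Q.L₁ - 2)) ≤
      ∑ y ∈ Y, (Q.unionWatch Y).exposure X p y := by
    rw [← hY, ← smul_eq_mul]
    exact card_nsmul_le_sum _ _ _ hexp
  have hsum' : ((Q.m * ((Q.D - 2 * Q.a - Q.L₁) * (Q.L₁ - 2)) : ℕ) : ℝ) ≤
      (∑ y ∈ Y, (Q.unionWatch Y).exposure X p y : ℕ) := by exact_mod_cast hsum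
  have hweight : Real.exp Q.w ≤ (Q.unionWatch Y).weight X p := by
    unfold Watch.weight
    rw [if_pos (by rw [hcov]; exact hW), hcov]
    refine Real.exp_le_exp.2 ?_
    have h1 := mul_le_mul_of_nonneg_left hsum' Q.rate₁_nonneg
    have h2 := Q.gain₁
    have h3 : ((Y.biUnion (palette p)).card : ℝ) ≤ Q.W := by exact_mod_cast hW
    simp only [unionWatch] at *
    linarith
  linarith [Q.weight_unionWatch_le_danger snap X p hY]

/-- As long as the colours of `v` are not recorded, the base of the pair watch moves along with
the play, there is no exposure, and the weight only decreases. -/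
theorem weight_pairWatch_play_le {X X' p : Position G Q.colors} {m : V × V × Fin Q.colors}
    (hm : Legal p m) (hX : Extends X p) (hX' : Extends X' p) (u v : V) :
    (Q.pairWatch (play p m) u v).weight X' (play p m) ≤ (Q.pairWatch p u v).weight X p := by
  have hext := extends_play hm
  have h1 : (Q.pairWatch (play p m) u v).weight X' (play p m) =
      if ((Q.pairWatch (play p m) u v).covered (play p m)).card ≤ Q.w then
        Real.exp (-((Q.pairWatch (play p m) u v).covered (play p m)).card) else 0 :=
    (Q.pairWatch (play p m) u v).weight_base Q.quota₂_pos (hX'.trans hext)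
  have h2 : (Q.pairWatch p u v).weight X p =
      if ((Q.pairWatch p u v).covered p).card ≤ Q.w then
        Real.exp (-((Q.pairWatch p u v).covered p).card) else 0 :=
    (Q.pairWatch p u v).weight_base Q.quota₂_pos hX
  have hcard : ((Q.pairWatch p u v).covered p).card ≤
      ((Q.pairWatch (play p m) u v).covered (play p m)).card := by
    refine card_le_card ?_
    simp only [Watch.covered, pairWatch, singleton_biUnion]
    exact inter_subset_inter (hext.palette_subset v) (hext.palette_subset u)
  by_cases h3 : ((Q.pairWatch (play p m) u v).covered (play p m)).card ≤ Q.w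
  · rw [h1, h2, if_pos h3, if_pos (hcard.trans h3)]
    exact Real.exp_le_exp.2 (neg_le_neg (by exact_mod_cast hcard))
  · rw [h1, if_neg h3]
    exact Watch.weight_nonneg _ _ _

variable {Q}

theorem Tracked.danger_breaker_le {snap : V → Position G Q.colors} {X p : Position G Q.colors}
    (h : Q.Tracked snap X p 1) {m : V × V × Fin Q.colors} (hm : Legal p m) :
    Q.danger (Q.advance snap (play p m)) X (play p m) ≤ Q.danger snap X p := by
  have hX : ∀ y, (palette (play p m) y).card ≤ (palette X y).card + 2 := by
    intro y
    have h1 := card_palette_play_le hm y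
    have h2 := h.step y
    omega
  unfold danger
  refine add_le_add (sum_le_sum fun Y _ => ?_) (sum_le_sum fun u _ => sum_le_sum fun v _ => ?_)
  · exact Watch.weight_play_le _ Q.rate₁_nonneg hm h.proper
      (fun e i he => by simp [unionWatch] at he) hX
  · unfold advance
    split_ifs with hv
    · rw [h.snap_eq v hv]
      exact Q.weight_pairWatch_play_le hm h.ext h.ext u v
    · exact Watch.weight_play_le _ Q.rate₂_nonneg hm h.proper (h.snap_ext v) hX

theorem Tracked.exists_danger_maker_le (hD : ∀ x, (nbrs G x).card ≤ Q.D)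
    {snap : V → Position G Q.colors} {X p : Position G Q.colors}
    (h : Q.Tracked snap X p 2) {m₀ : V × V × Fin Q.colors} (hm₀ : Legal p m₀) :
    ∃ m, Legal p m ∧
      Q.danger (Q.advance snap (play p m)) p (play p m) ≤ Q.danger snap X p := by
  -- The move `m₀` makes the set of choices nonempty when no edge with a touched end is left.
  set S := insert m₀ (candidates X p) with hS
  have hleg : ∀ m ∈ S, Legal p m := by
    intro m hm
    rcases mem_insert.1 hm with rfl | hm
    · exact hm₀
    · exact (mem_filter.1 hm).2.1
  have hK : S.card ≤ Q.K := by
    have h1 : S.card ≤ (candidates X p).card + 1 := card_insert_le _ _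
    have h2 := card_candidates_le hD X p
    have h3 := Nat.mul_le_mul_right (Q.D * Q.colors) (Nat.mul_le_mul_left 2 h.card_touched)
    have h4 := Q.card_le
    unfold colors at *
    omega
  have hsum : ∑ m ∈ S, Q.danger (Q.advance snap (play p m)) p (play p m) ≤
      ∑ m ∈ S, Q.danger snap X p := by
    rw [sum_const, nsmul_eq_mul]
    simp only [danger, sum_add_distrib, mul_add, mul_sum]
    refine add_le_add ?_ ?_
    · rw [sum_comm]
      refine sum_le_sum fun Y _ => ?_
      exact Watch.sum_weight_play_le _ Q.rate₁_nonneg h.proper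
        (fun e i he => by simp [unionWatch] at he) h.step Q.room₁ Q.rate₁_le (subset_insert _ _)
        hleg hK
    · rw [sum_comm]
      refine sum_le_sum fun u _ => ?_
      rw [sum_comm]
      refine sum_le_sum fun v _ => ?_
      unfold advance
      split_ifs with hv
      · rw [h.snap_eq v hv, ← nsmul_eq_mul]
        exact sum_le_card_nsmul _ _ _ fun m hm =>
          Q.weight_pairWatch_play_le (hleg m hm) h.ext (Extends.refl p) u v
      · exact Watch.sum_weight_play_le _ Q.rate₂_nonneg h.proper (h.snap_ext v) h.step Q.room₂
          Q.rate₂_le (subset_insert _ _) hleg hK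
  obtain ⟨m, hm, hle⟩ := exists_le_of_sum_le ⟨m₀, mem_insert_self _ _⟩ hsum
  exact ⟨m, hleg m hm, hle⟩

theorem Tracked.advance {snap : V → Position G Q.colors} {X X' p : Position G Q.colors} {t t' : ℕ}
    (h : Q.Tracked snap X p t) {m : V × V × Fin Q.colors} (hm : Legal p m)
    (hX' : Extends X' p) (hcard : (touched X' p).card + 2 ≤ 2 * t')
    (hstep : ∀ x, (palette p x).card + 1 ≤ (palette X' x).card + t')
    (hd : Q.danger (Q.advance snap (play p m)) X' (play p m) < Real.exp Q.w) :
    Q.Tracked (Q.advance snap (play p m)) X' (play p m) t' := by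
  have hext := extends_play hm
  have hsnap : ∀ v, Extends (Q.advance snap (play p m) v) (play p m) := by
    intro v
    unfold Params.advance
    split_ifs
    · exact Extends.refl _
    · exact (h.snap_ext v).trans hext
  refine ⟨proper_play hm h.proper, hX'.trans hext, hsnap,
    (card_touched_play_le hm).trans hcard,
    fun x => (card_palette_play_le hm x).trans (hstep x), ?_, ?_, ?_, ?_, hd⟩
  · intro u v
    by_cases hu : (palette (snap u) u).card < Q.D - Q.a
    · right
      rw [show Q.advance snap (play p m) u = play p m from if_pos hu]
      exact hsnap v
    · by_cases hv : (palette (snap v) v).card < Q.D - Q.a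
      · left
        rw [show Q.advance snap (play p m) v = play p m from if_pos hv]
        exact hsnap u
      · rw [show Q.advance snap (play p m) u = snap u from if_neg hu,
          show Q.advance snap (play p m) v = snap v from if_neg hv]
        exact h.chain u v
  · intro v
    unfold Params.advance
    split_ifs with hv
    · have h1 := card_palette_play_le hm v
      rw [h.snap_eq v hv] at hv
      omega
    · exact h.snap_le v
  · intro v
    unfold Params.advance
    split_ifs with hv
    · exact fun _ => rfl
    · exact fun hlt => absurd hlt hv
  · intro v
    unfold Params.advance
    split_ifs with hv
    · exact Q.wellSpread_of_danger_lt hd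
    · exact h.spread v

/-- If `T` has `D - a` colours, few vertices contain almost all of `T`: the colours of such
vertices lie in `T` up to `2 * a` each, so `m` of them have a small union. -/
theorem WellSpread.card_lt {s : Position G Q.colors} (hs : Q.WellSpread s)
    (hD : ∀ x, (nbrs G x).card ≤ Q.D) {T : Finset (Fin Q.colors)} (hT : T.card = Q.D - Q.a)
    {B : Finset V} (hB : ∀ z ∈ B, (T \ palette s z).card < Q.a) : B.card < Q.m := by
  by_contra! hlt
  obtain ⟨Y, hYB, hY⟩ := exists_subset_card_eq hlt
  have ha := Q.a_le
  have hbig : ∀ y ∈ Y, Q.D - 2 * Q.a ≤ (palette s y).card ∧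
      (palette s y \ T).card ≤ 2 * Q.a := by
    intro y hy
    have h1 := hB y (hYB hy)
    have h2 := card_sdiff_add_card_inter T (palette s y)
    have h3 := card_sdiff_add_card_inter (palette s y) T
    have h4 := (card_palette_le_nbrs s y).trans (hD y)
    rw [inter_comm] at h3
    omega
  have hW := hs Y hY fun y hy => (hbig y hy).1
  have hsub : Y.biUnion (palette s) ⊆ T ∪ Y.biUnion fun y => palette s y \ T := by
    intro i hi
    obtain ⟨y, hy, hiy⟩ := mem_biUnion.1 hi
    by_cases hiT : i ∈ T
    · exact mem_union_left _ hiT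
    · exact mem_union_right _ (mem_biUnion.2 ⟨y, hy, mem_sdiff.2 ⟨hiy, hiT⟩⟩)
  have h1 := (card_le_card hsub).trans (card_union_le _ _)
  have h2 := card_biUnion_le_card_mul Y (fun y => palette s y \ T) (2 * Q.a)
    fun y hy => (hbig y hy).2
  have h3 := Q.union_le
  rw [hY] at h2
  omega

/-- An edge `uv` without available colours would have ends with at least `D - w` colours each, at
most `w` of them in common. If `v` was recorded first, then most neighbours of `u` along
uncoloured edges missed `a` of the recorded colours of `v`, so that afterwards `u` was much
exposed to these colours and the pair watch has weight at least `exp w`. -/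
theorem Tracked.not_blocked_of_extends {snap : V → Position G Q.colors}
    {X p : Position G Q.colors} {t : ℕ} (hD : ∀ x, (nbrs G x).card ≤ Q.D)
    (h : Q.Tracked snap X p t) {u v : V}
    (hsnap : Extends (snap v) (snap u)) (hcov : palette p u ∪ palette p v = univ) : False := by
  have hcard := card_union_add_card_inter (palette p u) (palette p v)
  rw [hcov, card_univ, Fintype.card_fin] at hcard
  have hu := (card_palette_le_nbrs p u).trans (hD u)
  have hv := (card_palette_le_nbrs p v).trans (hD v)
  have ha := Q.a_le
  have hroom := Q.room₂
  have hk : Q.colors = 2 * Q.D - Q.w := rfl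
  have hint : (palette p u ∩ palette p v).card ≤ Q.w := by omega
  set s := snap v with hs
  have hfull : (palette s v).card = Q.D - Q.a := by
    refine le_antisymm (h.snap_le v) (not_lt.1 fun hlt => ?_)
    have := h.snap_eq v hlt
    rw [← hs] at this
    rw [this] at hlt
    omega
  have hsu : (palette s u).card ≤ Q.D - Q.a := (hsnap.card_palette_le u).trans (h.snap_le u)
  have hpart : Q.a - Q.w - Q.m ≤ ((Q.pairWatch s u v).partners u).card := by
    set F := (nbrs G u).filter (Uncolored s u ·) with hF
    have h1 : (nbrs G u).card ≤ F.card + (palette s u).card :=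
      card_nbrs_le ((h.snap_ext v).proper h.proper) u
    have h2 := card_palette_le_nbrs p u
    have h3 : (F.filter fun z => (palette s v \ palette s z).card < Q.a).card < Q.m :=
      (h.spread v).card_lt hD hfull fun z hz => (mem_filter.1 hz).2
    have h4 := card_filter_add_card_filter_not (s := F)
      fun z => (palette s v \ palette s z).card < Q.a
    have h5 : F.filter (fun z => ¬ (palette s v \ palette s z).card < Q.a) ⊆
        (Q.pairWatch s u v).partners u := by
      intro z hz
      rw [mem_filter, hF, mem_filter] at hz
      exact (Watch.mem_partners _).2 ⟨hz.1.2, not_lt.1 hz.2⟩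
    have h6 := card_le_card h5
    omega
  have hexp : (Q.a - Q.w - Q.m - Q.L₂) * (Q.L₂ - 2) ≤ (Q.pairWatch s u v).exposure X p u := by
    unfold Watch.exposure
    rw [if_pos]
    · exact Nat.mul_le_mul_right _ (Nat.sub_le_sub_right hpart _)
    · simp only [pairWatch]
      omega
  have hexp' : (((Q.a - Q.w - Q.m - Q.L₂) * (Q.L₂ - 2) : ℕ) : ℝ) ≤
      ((Q.pairWatch s u v).exposure X p u : ℕ) := by exact_mod_cast hexp
  have hc : ((Q.pairWatch s u v).covered p).card ≤ Q.w := by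
    refine (card_le_card ?_).trans hint
    simp only [Watch.covered, pairWatch, singleton_biUnion]
    rw [inter_comm]
    exact inter_subset_inter_left ((h.snap_ext v).palette_subset v)
  have hc' : (((Q.pairWatch s u v).covered p).card : ℝ) ≤ Q.w := by exact_mod_cast hc
  have hweight : Real.exp Q.w ≤ (Q.pairWatch s u v).weight X p := by
    unfold Watch.weight
    rw [if_pos (show _ ≤ (Q.pairWatch s u v).cap from hc)]
    refine Real.exp_le_exp.2 ?_
    have h1 := mul_le_mul_of_nonneg_left hexp' Q.rate₂_nonneg
    have h2 := Q.gain₂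
    rw [show (Q.pairWatch s u v).verts = {u} from rfl, sum_singleton,
      show (Q.pairWatch s u v).rate = Q.b₂ from rfl]
    linarith
  linarith [Q.weight_pairWatch_le_danger snap X p u v, h.danger_lt]

theorem Tracked.exists_legal {snap : V → Position G Q.colors} {X p : Position G Q.colors} {t : ℕ}
    (hD : ∀ x, (nbrs G x).card ≤ Q.D) (h : Q.Tracked snap X p t) {u v : V}
    (huv : Uncolored p u v) : ∃ i, Legal p (u, v, i) := by
  by_contra! hno
  have hcov : palette p u ∪ palette p v = univ := by
    refine eq_univ_iff_forall.2 fun i => ?_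
    by_contra hi
    rw [mem_union, not_or] at hi
    exact hno i ⟨huv, hi.1, hi.2⟩
  rcases h.chain u v with hc | hc
  · exact h.not_blocked_of_extends hD hc (by rwa [union_comm])
  · exact h.not_blocked_of_extends hD hc hcov

theorem tracked_start (hn : (Fintype.card V : ℝ) ^ Q.m + (Fintype.card V : ℝ) ^ 2 < Real.exp Q.w)
    (t : ℕ) : Q.Tracked (G := G) (fun _ _ => none) (fun _ => none) (fun _ => none) t := by
  have hpal : ∀ x : V, palette (fun _ => none : Position G Q.colors) x = ∅ := by
    intro x
    simp [palette]
  have hd : Q.danger (G := G) (fun _ _ => none) (fun _ => none) (fun _ => none) <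
      Real.exp Q.w := by
    refine lt_of_le_of_lt ?_ hn
    unfold danger
    refine add_le_add ?_ ?_
    · calc ∑ Y ∈ powersetCard Q.m (univ : Finset V),
            (Q.unionWatch (G := G) Y).weight (fun _ => none) (fun _ => none)
          ≤ ∑ Y ∈ powersetCard Q.m (univ : Finset V), (1 : ℝ) :=
            sum_le_sum fun Y _ => (Q.unionWatch Y).weight_base_le_one Q.quota₁_pos (Extends.refl _)
        _ = ((Fintype.card V).choose Q.m : ℝ) := by
            rw [sum_const, card_powersetCard, nsmul_eq_mul, mul_one, card_univ]
        _ ≤ (Fintype.card V : ℝ) ^ Q.m := by exact_mod_cast Nat.choose_le_pow _ _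
    · calc ∑ u : V, ∑ v : V, (Q.pairWatch (G := G) (fun _ => none) u v).weight
              (fun _ => none) (fun _ => none)
          ≤ ∑ u : V, ∑ v : V, (1 : ℝ) :=
            sum_le_sum fun u _ => sum_le_sum fun v _ =>
              (Q.pairWatch (fun _ => none) u v).weight_base_le_one Q.quota₂_pos (Extends.refl _)
        _ = (Fintype.card V : ℝ) ^ 2 := by simp [sq]
  refine ⟨?_, Extends.refl _, fun _ => Extends.refl _, ?_, fun x => by omega,
    fun _ _ => Or.inl (Extends.refl _), fun v => ?_, fun _ _ => rfl,
    fun _ => Q.wellSpread_of_danger_lt hd, hd⟩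
  · intro e f x i _ _ he
    simp at he
  · rw [touched_self]
    simp
  · rw [hpal, card_empty]
    omega

/-- Maker keeps `danger` below `exp w`. A strategy may depend on the position only, so Maker picks
any tracking data that fits the position he sees, and moves accordingly. -/
theorem makerWins (hD : ∀ x, (nbrs G x).card ≤ Q.D)
    (hn : (Fintype.card V : ℝ) ^ Q.m + (Fintype.card V : ℝ) ^ 2 < Real.exp Q.w)
    (first : Player) : MakerWins G Q.colors first := by
  let Good : Position G Q.colors → Position G Q.colors → Prop := fun p q =>
    Move p q ∧ ∃ snap, Q.Tracked snap p q 1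
  have hnext : ∀ p snap X, Q.Tracked snap X p 2 → ¬ IsOver p → ∃ q, Good p q := by
    intro p snap X h hover
    obtain ⟨q, hq⟩ := not_forall_not.1 hover
    obtain ⟨m₀, hm₀, -⟩ := hq.exists_legal
    obtain ⟨m, hm, hle⟩ := h.exists_danger_maker_le hD hm₀
    refine ⟨play p m, move_play hm, _, h.advance hm (Extends.refl p) ?_ (fun x => le_rfl)
      (hle.trans_lt h.danger_lt)⟩
    rw [touched_self]
    simp
  let σ : Strategy G Q.colors := fun p => if h : ∃ q, Good p q then h.choose else p
  have hσ : ∀ p snap X, Q.Tracked snap X p 2 → ¬ IsOver p → Good p (σ p) := by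
    intro p snap X h hover
    have hex := hnext p snap X h hover
    simp only [σ, dif_pos hex]
    exact hex.choose_spec
  let turn : Player → ℕ := fun t => match t with
    | Player.maker => 2
    | Player.breaker => 1
  have hreach : ∀ t p, Reachable σ first t p → ∃ snap X, Q.Tracked snap X p (turn t) := by
    intro t p hr
    induction hr with
    | start => exact ⟨_, _, tracked_start hn _⟩
    | makerMove p _ hmove ih =>
      obtain ⟨snap, X, h⟩ := ih
      obtain ⟨-, snap', h'⟩ := hσ p snap X h fun hover => hover _ hmove
      exact ⟨snap', p, h'⟩
    | breakerMove p q _ hmove ih =>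
      obtain ⟨snap, X, h⟩ := ih
      obtain ⟨m, hm, rfl⟩ := hmove.exists_legal
      refine ⟨_, X, h.advance hm h.ext ?_ (fun x => ?_)
        ((h.danger_breaker_le hm).trans_lt h.danger_lt)⟩
      · have := h.card_touched
        simp only [turn] at this ⊢
        omega
      · have := h.step x
        simp only [turn] at this ⊢
        omega
  refine ⟨σ, ?_, ?_⟩
  · intro p hr hover
    obtain ⟨snap, X, h⟩ := hreach _ _ hr
    exact (hσ p snap X h hover).1
  · rintro t p hr hover ⟨e, he⟩ hpe
    obtain ⟨snap, X, h⟩ := hreach _ _ hr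
    induction e using Sym2.ind with
    | _ u v =>
    have huv : Uncolored p u v := ⟨he, fun f hf => by
      rw [show f = ⟨s(u, v), he⟩ from Subtype.ext hf, hpe]⟩
    obtain ⟨i, hi⟩ := h.exists_legal hD huv
    exact hover _ (move_play hi)

end Params

/-! ### Numerical constants -/

/-- Admissible numbers for large degree. The order of choice is `m`, then `a` small against `D /
m`, then `w` small against `a ^ 3 / D ^ 2`. -/
def Params.ofDegree (D : ℕ) (hD : 10 ^ 25 ≤ D) : Params where
  D := D
  a := D / 10 ^ 5
  w := D / 10 ^ 20
  m := 4096
  L₁ := D / 4 + 2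
  W := D + 4096 * (2 * (D / 10 ^ 5))
  g₁ := D / 2
  b₁ := (D / 2 : ℕ) / (144 * (D : ℝ) ^ 2)
  L₂ := D / 10 ^ 5 / 4
  g₂ := D / 10 ^ 5 / 2
  b₂ := (D / 10 ^ 5 / 2 : ℕ) / (144 * (D : ℝ) ^ 2)
  K := 18 * D ^ 2
  card_le := by
    have h1 : D * (2 * D - D / 10 ^ 20) ≤ D * (2 * D) := Nat.mul_le_mul_left _ (Nat.sub_le _ _)
    have h2 : 1 * 1 ≤ D * D := Nat.mul_le_mul (by omega) (by omega)
    nlinarith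
  a_le := by omega
  union_le := le_rfl
  quota₁_pos := by omega
  quota₁_le := by omega
  room₁ := by omega
  rate₁_nonneg := by positivity
  rate₁_le := by
    have : (0 : ℝ) < D := by exact_mod_cast (show 0 < D by omega)
    apply le_of_eq
    push_cast
    field_simp
    ring
  gain₁ := by
    have hpos : (0 : ℝ) < D := by exact_mod_cast (show 0 < D by omega)
    generalize hA : D - 2 * (D / 10 ^ 5) - (D / 4 + 2) = A
    generalize hB : D / 4 + 2 - 2 = B
    generalize hW : D + 4096 * (2 * (D / 10 ^ 5)) = W
    generalize hw : D / 10 ^ 20 = w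
    generalize hg : D / 2 = g
    have hA' : (7 : ℝ) * D ≤ 10 * A := by exact_mod_cast (show 7 * D ≤ 10 * A by omega)
    have hB' : (D : ℝ) ≤ 5 * B := by exact_mod_cast (show D ≤ 5 * B by omega)
    have hg' : (D : ℝ) ≤ 3 * g := by exact_mod_cast (show D ≤ 3 * g by omega)
    have hW' : 10 * ((W : ℝ) + w) ≤ 11 * D := by
      exact_mod_cast (show 10 * (W + w) ≤ 11 * D by omega)
    push_cast
    have hAB : (7 / 10 * D : ℝ) * (1 / 5 * D) ≤ A * B :=
      mul_le_mul (by linarith) (by linarith) (by positivity) (by positivity)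
    have hgAB : (1 / 3 * D : ℝ) * (7 / 10 * D * (1 / 5 * D)) ≤ g * (A * B) :=
      mul_le_mul (by linarith) hAB (by positivity) (by positivity)
    rw [div_mul_eq_mul_div, le_div_iff₀ (by positivity)]
    have h1 : ((W : ℝ) + w) * (144 * D ^ 2) ≤ (11 / 10 * D) * (144 * D ^ 2) :=
      mul_le_mul_of_nonneg_right (by linarith) (by positivity)
    have h2 : (0 : ℝ) ≤ (D : ℝ) ^ 3 := by positivity
    nlinarith
  quota₂_pos := by omega
  room₂ := by omega
  rate₂_nonneg := by positivity
  rate₂_le := by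
    have : (0 : ℝ) < D := by exact_mod_cast (show 0 < D by omega)
    apply le_of_eq
    push_cast
    field_simp
    ring
  gain₂ := by
    have hpos : (0 : ℝ) < D := by exact_mod_cast (show 0 < D by omega)
    generalize hA : D / 10 ^ 5 - D / 10 ^ 20 - 4096 - D / 10 ^ 5 / 4 = A
    generalize hB : D / 10 ^ 5 / 4 - 2 = B
    generalize hw : D / 10 ^ 20 = w
    generalize hg : D / 10 ^ 5 / 2 = g
    have hA' : (6 : ℝ) * D ≤ 10 ^ 6 * A := by exact_mod_cast (show 6 * D ≤ 10 ^ 6 * A by omega)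
    have hB' : (2 : ℝ) * D ≤ 10 ^ 6 * B := by exact_mod_cast (show 2 * D ≤ 10 ^ 6 * B by omega)
    have hg' : (4 : ℝ) * D ≤ 10 ^ 6 * g := by exact_mod_cast (show 4 * D ≤ 10 ^ 6 * g by omega)
    have hw' : 10 ^ 20 * (w : ℝ) ≤ D := by
      exact_mod_cast (show 10 ^ 20 * w ≤ D by omega)
    push_cast
    have hAB : (6 / 10 ^ 6 * D : ℝ) * (2 / 10 ^ 6 * D) ≤ A * B :=
      mul_le_mul (by linarith) (by linarith) (by positivity) (by positivity)
    have hgAB : (4 / 10 ^ 6 * D : ℝ) * (6 / 10 ^ 6 * D * (2 / 10 ^ 6 * D)) ≤ g * (A * B) :=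
      mul_le_mul (by linarith) hAB (by positivity) (by positivity)
    rw [div_mul_eq_mul_div, le_div_iff₀ (by positivity)]
    have h1 : 2 * (w : ℝ) * (144 * D ^ 2) ≤ (2 / 10 ^ 20 * D) * (144 * D ^ 2) :=
      mul_le_mul_of_nonneg_right (by linarith) (by positivity)
    have h2 : (0 : ℝ) ≤ (D : ℝ) ^ 3 := by positivity
    nlinarith

theorem pow_add_sq_lt_exp {n x : ℝ} {m : ℕ} (hn : 2 ≤ n) (hm : 2 ≤ m)
    (hx : (m + 2 : ℕ) * Real.log n ≤ x) : n ^ m + n ^ 2 < Real.exp x := by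
  have h1 : n ^ 2 ≤ n ^ m := pow_le_pow_right₀ (by linarith) hm
  have h2 : 0 < n ^ m := by positivity
  have h3 : n ^ m * 4 ≤ n ^ (m + 2) := by
    rw [pow_add]
    exact mul_le_mul_of_nonneg_left (by nlinarith) h2.le
  have h4 : n ^ (m + 2) ≤ Real.exp x := by
    rw [← Real.exp_log (show 0 < n by linarith), ← Real.exp_nat_mul]
    exact Real.exp_le_exp.2 hx
  linarith

theorem makerWins_of_subsingleton {V : Type*} [Subsingleton V] (G : SimpleGraph V) (k : ℕ)
    (first : Player) : MakerWins G k first := by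
  have hno : ∀ e : G.edgeSet, False := by
    rintro ⟨e, he⟩
    induction e using Sym2.ind with
    | _ u v => exact G.ne_of_adj he (Subsingleton.elim u v)
  exact ⟨id, fun p _ hover => absurd (fun q ⟨e, _⟩ => hno e) hover, fun _ p _ _ e => (hno e).elim⟩

end

end EdgeColoringGame

theorem theorem1 :
    ∃ C c : ℝ, 0 < C ∧ 0 < c ∧
      ∀ (V : Type*) [Fintype V] (G : SimpleGraph V) [DecidableRel G.Adj]
        (first : EdgeColoringGame.Player),
        C * Real.log (Fintype.card V : ℝ) ≤ (G.maxDegree : ℝ) →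
        (EdgeColoringGame.gameChromaticIndex G first : ℝ) ≤ (2 - c) * (G.maxDegree : ℝ) := by
  refine ⟨10 ^ 26, 1 / 10 ^ 21, by positivity, by positivity, ?_⟩
  intro V _ G _ first hlog
  rcases Nat.lt_or_ge (Fintype.card V) 2 with hV | hV
  · have : Subsingleton V := Fintype.card_le_one_iff_subsingleton.1 (by omega)
    have h0 : EdgeColoringGame.gameChromaticIndex G first = 0 :=
      Nat.le_zero.1 (Nat.sInf_le (EdgeColoringGame.makerWins_of_subsingleton G 0 first))
    rw [h0, Nat.cast_zero]
    exact mul_nonneg (by norm_num) (Nat.cast_nonneg _)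
  have hV' : (2 : ℝ) ≤ Fintype.card V := by exact_mod_cast hV
  have hlog2 : (1 / 2 : ℝ) ≤ Real.log (Fintype.card V) :=
    (by linarith [Real.log_two_gt_d9] : (1 / 2 : ℝ) ≤ Real.log 2).trans
      (Real.log_le_log (by norm_num) hV')
  set D := G.maxDegree with hDdef
  have hD' : ((10 ^ 25 : ℕ) : ℝ) ≤ D := by
    push_cast
    linarith
  have hD : 10 ^ 25 ≤ D := by exact_mod_cast hD'
  let Q := EdgeColoringGame.Params.ofDegree D hD
  have hw : (D : ℝ) ≤ 2 * 10 ^ 20 * (D / 10 ^ 20 : ℕ) := by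
    exact_mod_cast (show D ≤ 2 * 10 ^ 20 * (D / 10 ^ 20) by omega)
  have hn : (Fintype.card V : ℝ) ^ Q.m + (Fintype.card V : ℝ) ^ 2 < Real.exp Q.w := by
    refine EdgeColoringGame.pow_add_sq_lt_exp hV' (show 2 ≤ 4096 by norm_num) ?_
    change ((4096 + 2 : ℕ) : ℝ) * _ ≤ ((D / 10 ^ 20 : ℕ) : ℝ)
    push_cast
    push_cast at hw
    linarith
  have hnbrs : ∀ x, (EdgeColoringGame.nbrs G x).card ≤ Q.D := by
    intro x
    refine le_trans (le_of_eq ?_) (G.degree_le_maxDegree x)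
    rw [← G.card_neighborFinset_eq_degree, G.neighborFinset_eq_filter]
    unfold EdgeColoringGame.nbrs
    congr
  have hle : EdgeColoringGame.gameChromaticIndex G first ≤ 2 * D - D / 10 ^ 20 :=
    Nat.sInf_le (Q.makerWins hnbrs hn first)
  have hle' : (EdgeColoringGame.gameChromaticIndex G first : ℝ) + (D / 10 ^ 20 : ℕ) ≤ 2 * D := by
    exact_mod_cast (show EdgeColoringGame.gameChromaticIndex G first + D / 10 ^ 20 ≤ 2 * D by omega)
  linarith
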